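/- All rings are commutative and unital. A ring $A$ is \emph{real closed} if it is reduced; its squares are the non-negative elements of a partial order making $A$ an $f$-ring (a lattice-ordered ring with $c(a\wedge b)=ca\wedge cb$ for $c\ge 0$); whenever $0\le a\le b$ there is $c\in A$ with $bc=a^2$; and for every prime ideal $\mathfrak p$ the ring $A/\mathfrak p$ is integrally closed with real closed quotient field. A \emph{real closed valuation ring} is a real closed ring that is a valuation ring; it is \emph{non-trivial} if it is not a field. $A$ is an \emph{SV-ring} if $A/\mathfrak p$ is a valuation ring for every prime ideal $\mathfrak p$. The \emph{rank} $\mathrm{rk}(A)\in\mathbb N\cup\{\infty\}$ is the supremum over the prime ideals $\mathfrak p$ of $A$ of the number of minimal prime ideals contained in $\mathfrak p$. \textbf{Theorem.} Let $n\ge 2$ and let $A$ be a ring which is not a field. The following are equivalent: (i) $A$ is a local real closed SV-ring of rank at most $n$. (ii) $A$ is a local real closed ring, and there are non-trivial real closed valuation rings $A_1,\dots,A_n$ and an injective ring homomorphism $\epsilon:A\to\prod_{i=1}^n A_i$ such that $\epsilon(A)$ is a subdirect product of $A_1,\dots,A_n$ (that is, $\epsilon(A)$ projects onto each $A_i$).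 (iii) There are non-trivial real closed valuation rings $A_1,\dots,A_n$ and an injective ring homomorphism $\epsilon:A\to\prod_{i=1}^n A_i$ such that, writing $S_j\subseteq\prod_{i\le j}A_i$ for the image of $A$ under $\epsilon$ followed by the projection onto the first $j$ factors, $S_1=A_1$ and for each $1\le j\le n-1$ there are prime ideals $\mathfrak i_j\subsetneq S_j$ and $\mathfrak j_{j+1}\subsetneq A_{j+1}$ and an isomorphism $S_j/\mathfrak i_j\cong A_{j+1}/\mathfrak j_{j+1}$ with $S_{j+1}=S_j\times_{A_{j+1}/\mathfrak j_{j+1}}A_{j+1}$, the fibre product being taken along the residue maps. In particular $$A\cong S_n=(((A_1\times_{A_2/\mathfrak j_2}A_2)\times_{A_3/\mathfrak j_3}A_3)\cdots)\times_{A_n/\mathfrak j_n}A_n .$$ (iv) There are prime ideals $\mathfrak p_1,\dots,\mathfrak p_n\subseteq A$ with $\bigcap_{i=1}^n\mathfrak p_i=(0)$ such that $\mathfrak q_j:=(\bigcap_{i=1}^{j-1}\mathfrak p_i)+\mathfrak p_j$ is a prime ideal for all $j\in\{2,\dots,n\}$, $A/\mathfrak p_i$ is a non-trivial real closed valuation ring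 for all $i\in\{1,\dots,n\}$, and the canonical homomorphism $A\to\prod_{i=1}^n A/\mathfrak p_i$ restricts to an isomorphism $$A\cong\Bigl(\Bigl(\tfrac{A}{\mathfrak p_1}\times_{A/\mathfrak q_2}\tfrac{A}{\mathfrak p_2}\Bigr)\times_{A/\mathfrak q_3}\tfrac{A}{\mathfrak p_3}\cdots\Bigr)\times_{A/\mathfrak q_n}\tfrac{A}{\mathfrak p_n}.$$ Moreover, if any of (i)--(iv) holds and $\mathrm{rk}(A)=n$, then any prime ideals $\mathfrak p_1,\dots,\mathfrak p_n$ as in (iv) are pairwise incomparable under inclusion, and $\{\mathfrak p_1,\dots,\mathfrak p_n\}$ is the set of minimal prime ideals of $A$. -/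

import Mathlib

universe u v

namespace RealClosedSV

/-! ### Real closed rings -/

/-- A real closed ring (in the sense of Schwartz): a reduced commutative ring whose squares are the
non-negative elements of a lattice order making it an `f`-ring, such that `0 ≤ a ≤ b` implies
`b ∣ a ^ 2`, and all of whose residue domains are integrally closed with real closed quotient
field. -/
structure IsRealClosedRing (A : Type u) [CommRing A] : Prop where
  isReduced : IsReduced A
  exists_order : ∃ (_ : Lattice A) (_ : IsOrderedRing A),
    (∀ a : A, 0 ≤ a ↔ IsSquare a) ∧
    (∀ a b c : A, 0 ≤ c → c * (a ⊓ b) = (c * a) ⊓ (c * b)) ∧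
    (∀ a b : A, 0 ≤ a → a ≤ b → ∃ c : A, b * c = a ^ 2)
  isRealClosed_fractionRing : ∀ (p : Ideal A) [p.IsPrime], IsRealClosed (FractionRing (A ⧸ p))
  isIntegrallyClosed : ∀ (p : Ideal A) [p.IsPrime], IsIntegrallyClosed (A ⧸ p)

/-- A non-trivial real closed valuation ring: a real closed ring which is a valuation ring (in
particular a domain) and which is not a field, i.e. differs from its quotient field. -/
structure IsNontrivialRCVR (A : Type u) [CommRing A] : Prop where
  isRealClosedRing : IsRealClosedRing A
  isDomain : IsDomain A
  valuationRing : ValuationRing A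
  not_isField : ¬ IsField A

/-! ### SV-rings and the rank -/

/-- An SV-ring: every residue domain is a valuation ring. -/
def IsSVRing (A : Type u) [CommRing A] : Prop :=
  ∀ (p : Ideal A) [p.IsPrime], ValuationRing (A ⧸ p)

/-- The rank of `A` at `p`: the number (possibly `∞`) of minimal prime ideals contained in `p`. -/
noncomputable def rankAt (A : Type u) [CommRing A] (p : Ideal A) : ℕ∞ :=
  {q : Ideal A | q ∈ minimalPrimes A ∧ q ≤ p}.encard

/-- The rank of `A`: the supremum of the ranks of its prime ideals. -/
noncomputable def rank (A : Type u) [CommRing A] : ℕ∞ :=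
  ⨆ p : PrimeSpectrum A, rankAt A p.asIdeal

/-! ### Subdirect products and stepwise fibre products

The factors are indexed by `Fin n`, so they are `B 0, …, B (n - 1)`. -/

section Products

variable {n : ℕ} (B : Fin n → Type u) [∀ i, CommRing (B i)]

/-- A subring of a product is a subdirect product of the factors if it projects onto each. -/
def IsSubdirectProduct (S : Subring (∀ i, B i)) : Prop :=
  ∀ i, Function.Surjective ((Pi.evalRingHom B i).comp S.subtype)

/-- The projection of the product of all `n` factors onto the product of the first `k`. -/
def truncate (k : ℕ) (hk : k ≤ n) : (∀ i, B i) →+* (∀ i : Fin k, B (Fin.castLE hk i)) :=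
  RingHom.pi fun i => Pi.evalRingHom B (Fin.castLE hk i)

/-- The image of `A` in the product of the first `k` factors. -/
def truncImage {A : Type v} [CommRing A] (ε : A →+* ∀ i, B i) (k : ℕ) (hk : k ≤ n) :
    Subring (∀ i : Fin k, B (Fin.castLE hk i)) :=
  ((truncate B k hk).comp ε).range

/-- The projection from the product of the first `k + 1` factors to that of the first `k`. -/
def init (k : ℕ) (hk : k < n) :
    (∀ i : Fin (k + 1), B (Fin.castLE hk i)) →+* (∀ i : Fin k, B (Fin.castLE hk.le i)) :=
  RingHom.pi fun i => Pi.evalRingHom (fun i : Fin (k + 1) => B (Fin.castLE hk i)) i.castSucc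

/-- The projection from the product of the first `k + 1` factors to the last of them. -/
def last (k : ℕ) (hk : k < n) :
    (∀ i : Fin (k + 1), B (Fin.castLE hk i)) →+* B ⟨k, hk⟩ :=
  Pi.evalRingHom (fun i : Fin (k + 1) => B (Fin.castLE hk i)) (Fin.last k)

/-- The fibre product `S ×_C B k` of a subring `S` of the product of the first `k` factors with the
next factor `B k`, along `f : S → C` and `g : B k → C`, regarded as a subring of the product of the
first `k + 1` factors: the `(s, b)` with `s ∈ S` and `f s = g b`. -/
def fibreProduct {k : ℕ} (hk : k < n) (S : Subring (∀ i : Fin k, B (Fin.castLE hk.le i)))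
    {C : Type v} [CommRing C] (f : S →+* C) (g : B ⟨k, hk⟩ →+* C) :
    Subring (∀ i : Fin (k + 1), B (Fin.castLE hk i)) where
  carrier := {x | ∃ s : S, (s : ∀ i : Fin k, B (Fin.castLE hk.le i)) = init B k hk x ∧
    f s = g (last B k hk x)}
  mul_mem' := by
    rintro x y ⟨s, hs, es⟩ ⟨t, ht, et⟩
    exact ⟨s * t, by simp [hs, ht], by simp [es, et]⟩
  one_mem' := ⟨1, by simp, by simp⟩
  add_mem' := by
    rintro x y ⟨s, hs, es⟩ ⟨t, ht, et⟩
    exact ⟨s + t, by simp [hs, ht], by simp [es, et]⟩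
  zero_mem' := ⟨0, by simp, by simp⟩
  neg_mem' := by
    rintro x ⟨s, hs, es⟩
    exact ⟨-s, by simp [hs], by simp [es]⟩

/-- `ε` embeds `A` as an iterated fibre product of the factors along prime ideals: the image of `A`
in the first factor is everything, and, for `1 ≤ k < n`, the image in the product of the first
`k + 1` factors is the fibre product of the image `S` in the product of the first `k` factors and
of the next factor `B k`, along the residue maps `S → S ⧸ I ≃ B k ⧸ J` and `B k → B k ⧸ J` for some
prime ideals `I`, `J` and some isomorphism of the residue rings. For `k + 1 = n` the left hand side
is the image of `ε` itself. -/
structure IsIteratedFibreEmbedding {A : Type v} [CommRing A] (ε : A →+* ∀ i, B i) : Prop where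
  injective : Function.Injective ε
  first : ∀ h : 1 ≤ n, truncImage B ε 1 h = ⊤
  step : ∀ (k : ℕ) (_ : 1 ≤ k) (hk : k < n),
    ∃ (I : Ideal (truncImage B ε k hk.le)) (J : Ideal (B ⟨k, hk⟩))
      (φ : (truncImage B ε k hk.le ⧸ I) ≃+* (B ⟨k, hk⟩ ⧸ J)),
      I.IsPrime ∧ J.IsPrime ∧
      truncImage B ε (k + 1) hk =
        fibreProduct B hk (truncImage B ε k hk.le)
          ((φ : (truncImage B ε k hk.le ⧸ I) →+* (B ⟨k, hk⟩ ⧸ J)).comp (Ideal.Quotient.mk I))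
          (Ideal.Quotient.mk J)

end Products

/-! ### The intrinsic description by prime ideals -/

section Intrinsic

variable {A : Type u} [CommRing A] {n : ℕ} (p : Fin n → Ideal A)

/-- The canonical homomorphism from `A` to the product of the residue rings `A ⧸ p i`. -/
def canonicalMap : A →+* ∀ i, A ⧸ p i :=
  RingHom.pi fun i => Ideal.Quotient.mk (p i)

/-- The ideal `(⋂ i < j, p i) + p j`. -/
def branchIdeal (j : Fin n) : Ideal A :=
  (⨅ i : Fin n, ⨅ _ : i < j, p i) ⊔ p j

/-- The image of `A` in the product of the first `k` residue rings `A ⧸ p i`. -/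
abbrev canonicalImage (k : ℕ) (hk : k ≤ n) :
    Subring (∀ i : Fin k, A ⧸ p (Fin.castLE hk i)) :=
  truncImage (fun i => A ⧸ p i) (canonicalMap p) k hk

theorem ker_le_branchIdeal (k : ℕ) (hk : k < n) :
    RingHom.ker ((truncate (fun i => A ⧸ p i) k hk.le).comp (canonicalMap p)) ≤
      branchIdeal p ⟨k, hk⟩ := by
  intro a ha
  refine Ideal.mem_sup_left ?_
  simp only [Ideal.mem_iInf]
  intro i hi
  have h := congrFun (RingHom.mem_ker.mp ha) ⟨i.1, hi⟩
  exact Ideal.Quotient.eq_zero_iff_mem.mp h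

/-- The homomorphism from the image of `A` in the product of the first `k` residue rings to
`A ⧸ branchIdeal p k` which sends the image of `a` to the class of `a`. -/
noncomputable def imageToResidue (k : ℕ) (hk : k < n) :
    canonicalImage p k hk.le →+* A ⧸ branchIdeal p ⟨k, hk⟩ :=
  (Ideal.Quotient.factor (ker_le_branchIdeal p k hk)).comp
    (RingHom.quotientKerEquivRange
      ((truncate (fun i => A ⧸ p i) k hk.le).comp (canonicalMap p))).symm.toRingHom

theorem imageToResidue_apply (k : ℕ) (hk : k < n) (a : A) :
    imageToResidue p k hk
        (((truncate (fun i => A ⧸ p i) k hk.le).comp (canonicalMap p)).rangeRestrict a) =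
      Ideal.Quotient.mk (branchIdeal p ⟨k, hk⟩) a := by
  have h : (RingHom.quotientKerEquivRange
      ((truncate (fun i => A ⧸ p i) k hk.le).comp (canonicalMap p))).symm
        (((truncate (fun i => A ⧸ p i) k hk.le).comp (canonicalMap p)).rangeRestrict a) =
      Ideal.Quotient.mk _ a := by
    rw [RingEquiv.symm_apply_eq]
    rfl
  exact congrArg (Ideal.Quotient.factor (ker_le_branchIdeal p k hk)) h

/-- The residue map `A ⧸ p j → A ⧸ branchIdeal p j`. -/
def residueToResidue (j : Fin n) : A ⧸ p j →+* A ⧸ branchIdeal p j :=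
  Ideal.Quotient.factor le_sup_right

/-- The prime ideals `p 0, …, p (n - 1)` have zero intersection, the ideals
`q j = (⋂ i < j, p i) + p j` with `j` not the first index are prime, the `A ⧸ p i` are non-trivial
real closed valuation rings, and the canonical map from `A` to the product of the `A ⧸ p i` is an
isomorphism onto the iterated fibre product
`((A ⧸ p 0 ×_{A ⧸ q 1} A ⧸ p 1) ×_{A ⧸ q 2} A ⧸ p 2) … ×_{A ⧸ q (n - 1)} A ⧸ p (n - 1)`
along the canonical maps. The last statement is split into the injectivity of the canonical map and
into the statements that each stage of the iterated fibre product is the image of `A`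
(the first stage, `A ⧸ p 0`, clearly is). -/
structure IsPrimePresentation : Prop where
  isPrime : ∀ i, (p i).IsPrime
  iInf_eq_bot : ⨅ i, p i = ⊥
  isPrime_branchIdeal : ∀ j : Fin n, 1 ≤ (j : ℕ) → (branchIdeal p j).IsPrime
  isNontrivialRCVR : ∀ i, IsNontrivialRCVR (A ⧸ p i)
  injective : Function.Injective (canonicalMap p)
  step : ∀ (k : ℕ) (_ : 1 ≤ k) (hk : k < n),
    canonicalImage p (k + 1) hk =
      fibreProduct (fun i => A ⧸ p i) hk (canonicalImage p k hk.le)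
        (imageToResidue p k hk) (residueToResidue p ⟨k, hk⟩)

end Intrinsic

end RealClosedSV

namespace RealClosedSV

/-! ### Transfer of real closed fields along isomorphisms -/

/-! The implications run in the cycle (i) ⇒ (iv) ⇒ (iii) ⇒ (ii) ⇒ (i).

For (i) ⇒ (iv), a local ring of rank at most `n` has at most `n` minimal primes, and these are
listed, possibly with repetitions, as `p i`; they intersect in zero because `A` is reduced. In a
real closed ring a sum of radical ideals is radical (`IsRealClosedRing.isRadical_sup`), and a proper
radical ideal containing `p j` is prime because `A ⧸ p j` is a valuation ring, so the branch ideals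
are prime. The fibre product formula is then formal: `A ⧸ (I ⊓ J)` is always the fibre product of `A
⧸ I` and `A ⧸ J` over `A ⧸ (I ⊔ J)`.

(iv) ⇒ (iii) only rewrites the gluing maps. The substance of (iii) ⇒ (ii) is that gluing two local
real closed rings along a common residue domain gives a local real closed ring. The order of a real
closed ring is determined by its squares, so the definition is first replaced by the lattice-free
axioms `IsElementaryRC`. These lift to a fibre product (`IsSurjectivePullback.isElementaryRC`)
because square roots in a domain are unique up to sign and signs can be corrected in one factor.

For (ii) ⇒ (i), the kernels of the projections are finitely many primes with zero intersection, so
every prime contains one of them. -/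

theorem isRealClosed_of_ringEquiv {K : Type u} {L : Type v} [Field K] [Field L] (e : K ≃+* L)
    [IsRealClosed K] : IsRealClosed L where
  one_add_ne_zero {s} hs h := by
    have hs' : IsSumSq (e.symm s) := by
      clear h
      induction hs with
      | zero => simp
      | sq_add a _ ih => simpa using ih.sq_add (e.symm a)
    refine IsSemireal.one_add_ne_zero hs' ?_
    rw [← map_one e.symm, ← map_add, h, map_zero]
  isSquare_or_isSquare_neg x := by
    rcases IsRealClosed.isSquare_or_isSquare_neg (e.symm x) with h | h
    · left; simpa using h.map e
    · right; simpa using h.map e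
  exists_isRoot_of_odd_natDegree {f} hf := by
    obtain ⟨x, hx⟩ := IsRealClosed.exists_isRoot_of_odd_natDegree
      (f := f.map (e.symm : L →+* K)) (by
        rwa [Polynomial.natDegree_map_eq_of_injective e.symm.injective])
    refine ⟨e x, ?_⟩
    have := hx.map (f := (e : K →+* L))
    rw [Polynomial.map_map] at this
    simpa using this

/-- A ring is a real closed domain in the weak sense that it is integrally closed and its fraction
ring is a real closed field. -/
def IsRealClosedResidue (D : Type u) [CommRing D] [IsDomain D] : Prop :=
  IsRealClosed (FractionRing D) ∧ IsIntegrallyClosed D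

theorem IsRealClosedResidue.of_ringEquiv {D : Type u} {E : Type v} [CommRing D] [CommRing E]
    [IsDomain D] [IsDomain E] (h : IsRealClosedResidue D) (e : D ≃+* E) :
    IsRealClosedResidue E := by
  obtain ⟨h₁, h₂⟩ := h
  exact ⟨isRealClosed_of_ringEquiv
    (IsFractionRing.ringEquivOfRingEquiv (K := FractionRing D) (L := FractionRing E) e),
    IsIntegrallyClosed.of_equiv e⟩

/-- The fraction field is formally real: if `x` were non-zero, dividing by its square would give `1
+ (y / x) ^ 2 = 0`. -/
theorem IsRealClosedResidue.eq_zero_of_mul_self_add_mul_self {D : Type u} [CommRing D] [IsDomain D]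
    (h : IsRealClosedResidue D) {x y : D} (hxy : x * x + y * y = 0) : x = 0 := by
  have := h.1
  by_contra hx
  have hx' : algebraMap D (FractionRing D) x ≠ 0 := by
    simpa [FaithfulSMul.algebraMap_eq_zero_iff] using hx
  have key := congrArg (algebraMap D (FractionRing D)) hxy
  simp only [map_add, map_mul, map_zero] at key
  set a := algebraMap D (FractionRing D) x
  set b := algebraMap D (FractionRing D) y
  refine IsSemireal.one_add_ne_zero (IsSumSq.mul_self (b / a)) ?_
  field_simp
  linear_combination key

/-! ### A lattice-free description of real closed rings -/

/-- A description of real closed rings which does not mention the lattice structure. -/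
structure IsElementaryRC (A : Type u) [CommRing A] : Prop where
  eq_zero_of_add : ∀ x y : A, x * x + y * y = 0 → x = 0
  isSquare_add : ∀ x y : A, IsSquare (x * x + y * y)
  exists_sub : ∀ a : A, ∃ u v : A, a = u * u - v * v ∧ u * v = 0
  exists_mul_eq : ∀ u v : A, ∃ c : A, (u * u + v * v) * c = (u * u) ^ 2 ∧
    ∀ P : Ideal A, P.IsPrime → u ∈ P → c ∈ P
  residue : ∀ (p : Ideal A) [p.IsPrime], IsRealClosedResidue (A ⧸ p)

section Lattice

variable {A : Type u} [CommRing A] [Lattice A] [IsOrderedRing A]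

theorem mul_sup_of_mul_inf (hinf : ∀ a b c : A, 0 ≤ c → c * (a ⊓ b) = (c * a) ⊓ (c * b))
    (a b c : A) (hc : 0 ≤ c) : c * (a ⊔ b) = (c * a) ⊔ (c * b) := by
  have h := hinf (-a) (-b) c hc
  rw [← neg_sup, mul_neg, mul_neg, mul_neg, ← neg_sup] at h
  exact neg_injective h

theorem posPart_mul_negPart_eq_zero
    (hinf : ∀ a b c : A, 0 ≤ c → c * (a ⊓ b) = (c * a) ⊓ (c * b))
    (hsq : ∀ a : A, 0 ≤ a * a) (a : A) : a⁺ * a⁻ = 0 := by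
  have h0 := posPart_inf_negPart_eq_zero a
  have hp := posPart_nonneg a
  have hn := negPart_nonneg a
  have h1 := hinf _ _ _ hp |>.symm.trans (by rw [h0, mul_zero])
  have h2 := hinf _ _ _ hn |>.symm.trans (by rw [h0, mul_zero])
  have h3 := hsq a
  set p := a⁺
  set q := a⁻
  have ha : a = p - q := (posPart_sub_negPart a).symm
  rw [mul_comm q p] at h2
  have hpq : 0 ≤ p * q := mul_nonneg hp hn
  have hle : p * q + p * q ≤ p * p + q * q := by
    rw [ha] at h3
    rw [← sub_nonneg]
    convert h3 using 1
    ring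
  -- Both `p * q` and `q * q` bound `p * q - p * p` from above, and their infimum is zero by `h2`.
  -- Hence `p * q ≤ p * p`, and `h1` collapses to `p * q = 0`.
  have h4 : p * q - p * p ≤ 0 := by
    rw [← h2]
    refine le_inf (sub_le_self _ (mul_nonneg hp hp)) ?_
    rw [sub_le_iff_le_add']
    exact (le_add_of_nonneg_right hpq).trans hle
  rw [sub_nonpos] at h4
  rwa [inf_eq_right.mpr h4] at h1

end Lattice

theorem IsRealClosedRing.isElementaryRC {A : Type u} [CommRing A] (h : IsRealClosedRing A) :
    IsElementaryRC A := by
  obtain ⟨hred, ⟨_, _, hsq, hinf, hdvd⟩, hrc, hic⟩ := h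
  have hms : ∀ a : A, a * a = 0 → a = 0 := fun a ha => IsReduced.eq_zero a ⟨2, by rw [sq, ha]⟩
  have hnn : ∀ a : A, 0 ≤ a * a := fun a => (hsq _).2 ⟨a, rfl⟩
  refine ⟨fun x y hxy => ?_, fun x y => (hsq _).1 (add_nonneg (hnn x) (hnn y)), fun a => ?_,
    fun u v => ?_, fun p _ => ⟨hrc p, hic p⟩⟩
  · have : x * x = 0 := by
      refine le_antisymm ?_ (hnn x)
      rw [← hxy]
      exact le_add_of_nonneg_right (hnn y)
    exact hms x this
  · obtain ⟨u, hu⟩ := (hsq _).1 (posPart_nonneg a)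
    obtain ⟨v, hv⟩ := (hsq _).1 (negPart_nonneg a)
    refine ⟨u, v, by rw [← hu, ← hv, posPart_sub_negPart], ?_⟩
    have := posPart_mul_negPart_eq_zero hinf hnn a
    rw [hu, hv] at this
    refine hms _ ?_
    linear_combination this
  · have ha := hnn u
    have hb : u * u ≤ u * u + v * v := le_add_of_nonneg_right (hnn v)
    set a := u * u with hua
    set b := a + v * v
    obtain ⟨c, hc⟩ := hdvd a b ha hb
    have hb0 := ha.trans hb
    -- Truncating `c` to the interval from `0` to `a` keeps the equation, since `0 ≤ a ^ 2 ≤ b * a`.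
    -- It also makes `a` divide the square of the witness, which forces the witness into every prime
    -- containing `u`.
    refine ⟨(c ⊓ a) ⊔ 0, ?_, fun P hP hu => ?_⟩
    · rw [mul_sup_of_mul_inf hinf _ _ _ hb0, hinf _ _ _ hb0, hc, mul_zero,
        inf_eq_left.2, sup_eq_left.2]
      · rw [sq]; exact mul_nonneg ha ha
      · rw [sq]; exact mul_le_mul_of_nonneg_right hb ha
    · obtain ⟨d, hd⟩ := hdvd ((c ⊓ a) ⊔ 0) a le_sup_right (sup_le inf_le_right ha)
      refine hP.mem_of_pow_mem 2 ?_
      rw [← hd]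
      exact P.mul_mem_right _ (P.mul_mem_right _ hu)

namespace IsElementaryRC

variable {A : Type u} [CommRing A] (h : IsElementaryRC A)
include h

theorem eq_zero_of_isSquare {s : A} (hs : IsSquare s) (hs' : IsSquare (-s)) : s = 0 := by
  obtain ⟨x, hx⟩ := hs
  obtain ⟨y, hy⟩ := hs'
  rw [hx, h.eq_zero_of_add x y (by rw [← hx, ← hy, add_neg_cancel]), mul_zero]

theorem mul_self_eq_zero {x : A} (hx : x * x = 0) : x = 0 :=
  h.eq_zero_of_add x 0 (by rw [hx, mul_zero, add_zero])

theorem isReduced : IsReduced A := by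
  rw [isReduced_iff_pow_one_lt 2 one_lt_two]
  exact fun x hx => h.mul_self_eq_zero (by rw [← sq, hx])

theorem isSquare_add' {x y : A} (hx : IsSquare x) (hy : IsSquare y) : IsSquare (x + y) := by
  obtain ⟨a, rfl⟩ := hx
  obtain ⟨b, rfl⟩ := hy
  exact h.isSquare_add a b

/-- This makes `u * u` the positive part of `x`, that is, the least upper bound of `x` and `0`.
Where `v` does not vanish, `u` does and `b - u * u = b` is non-negative; where `v` vanishes, `u * u
= x` is below `b`. So the negative part `q * q` of `b - u * u` is zero; algebraically, `h1` and `h2`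
each exhibit a vanishing sum of two squares. -/
theorem isSquare_sub_of_orthogonal {x u v b : A} (hx : x = u * u - v * v) (huv : u * v = 0)
    (hb : IsSquare b) (hbx : IsSquare (b - x)) : IsSquare (b - u * u) := by
  obtain ⟨p, q, hd, hpq⟩ := h.exists_sub (b - u * u)
  obtain ⟨β, rfl⟩ := hb
  obtain ⟨η, hη⟩ := hbx
  subst hx
  have h1 : q * q * v = 0 := by
    refine h.eq_zero_of_add _ (q * v * β) ?_
    linear_combination (q * q * v * v) * hd + (q * q * u * v) * huv + (v * v * p * q) * hpq
  have h2 : q * q = 0 := by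
    refine h.eq_zero_of_add _ (q * η) ?_
    linear_combination q * q * hd + p * q * hpq + v * h1 - q * q * hη
  rw [hd, h2, sub_zero]
  exact ⟨p, rfl⟩

theorem isRealClosedRing : IsRealClosedRing A := by
  refine ⟨h.isReduced, ?_, fun p _ => (h.residue p).1, fun p _ => (h.residue p).2⟩
  choose u v huv huv0 using h.exists_sub
  have hpos : ∀ x : A, IsSquare (u x * u x) := fun x => ⟨u x, rfl⟩
  have hneg : ∀ x : A, IsSquare (u x * u x - x) := fun x => ⟨v x, by linear_combination -huv x⟩
  have hleast : ∀ x b : A, IsSquare b → IsSquare (b - x) → IsSquare (b - u x * u x) :=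
    fun x b => h.isSquare_sub_of_orthogonal (huv x) (huv0 x)
  -- With `u x * u x` as the positive part of `x`, the supremum is `a + (b - a)⁺` and the infimum is
  -- `b - (b - a)⁺`.
  let L : Lattice A :=
    { le := fun a b => IsSquare (b - a)
      le_refl := fun a => by simp
      le_trans := fun a b c hab hbc => by
        have := h.isSquare_add' hab hbc
        rwa [add_comm, sub_add_sub_cancel] at this
      le_antisymm := fun a b hab hba =>
        (sub_eq_zero.1 (h.eq_zero_of_isSquare hab (by rwa [neg_sub]))).symm
      sup := fun a b => a + u (b - a) * u (b - a)
      inf := fun a b => b - u (b - a) * u (b - a)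
      le_sup_left := fun a b => by simp
      le_sup_right := fun a b => by
        convert hneg (b - a) using 1
        ring
      sup_le := fun a b c hac hbc => by
        convert hleast (b - a) (c - a) hac (by simpa using hbc) using 1
        ring
      inf_le_left := fun a b => by
        convert hneg (b - a) using 1
        ring
      inf_le_right := fun a b => by simp
      le_inf := fun a b c hab hac => by
        convert hleast (c - b) (c - a) hac (by simpa using hab) using 1
        ring }
  have hle : ∀ a b : A, a ≤ b ↔ IsSquare (b - a) := fun _ _ => Iff.rfl
  have hinf : ∀ a b : A, a ⊓ b = b - u (b - a) * u (b - a) := fun _ _ => rfl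
  have hord : IsOrderedAddMonoid A :=
    { add_le_add_left := fun a b hab c => by simpa [hle] using hab }
  have h01 : ZeroLEOneClass A := ⟨(hle _ _).2 ⟨1, by simp⟩⟩
  have hR : IsOrderedRing A := IsOrderedRing.of_mul_nonneg
    (fun a b ha hb => by
      simp only [hle, sub_zero] at *
      exact ha.mul hb)
  refine ⟨L, hR, fun a => by simp [hle], fun a b c hc => ?_, fun a b ha hab => ?_⟩
  · simp only [hle, sub_zero] at hc
    obtain ⟨γ, rfl⟩ := hc
    simp only [hinf]
    have hx := huv (b - a)
    have h0 := huv0 (b - a)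
    -- Scaling by `γ * γ` commutes with positive parts: the scaled decomposition is again
    -- orthogonal, so both candidates are least upper bounds, and `e1`, `e2` compare them in the two
    -- directions.
    have e1 := h.isSquare_sub_of_orthogonal
      (x := γ * γ * b - γ * γ * a) (u := γ * u (b - a)) (v := γ * v (b - a))
      (b := u (γ * γ * b - γ * γ * a) * u (γ * γ * b - γ * γ * a))
      (by linear_combination γ * γ * hx) (by linear_combination γ * γ * h0) (hpos _) (hneg _)
    have e2 := hleast (γ * γ * b - γ * γ * a) (γ * u (b - a) * (γ * u (b - a))) ⟨_, rfl⟩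
      ⟨γ * v (b - a), by linear_combination -(γ * γ) * hx⟩
    have := h.eq_zero_of_isSquare e1 (by rwa [neg_sub])
    linear_combination this
  · simp only [hle, sub_zero] at ha hab
    obtain ⟨x, rfl⟩ := ha
    obtain ⟨y, hy⟩ := hab
    obtain ⟨c, hc, -⟩ := h.exists_mul_eq x y
    exact ⟨c, by rw [← hc, ← hy]; ring⟩

end IsElementaryRC

/-! ### Homomorphic images -/

theorem isRealClosedResidue_quotient_of_surjective {R : Type u} {S : Type v} [CommRing R]
    [CommRing S] (f : R →+* S) (hf : Function.Surjective f)
    (hS : ∀ (p : Ideal S) [p.IsPrime], IsRealClosedResidue (S ⧸ p)) (P : Ideal R) [P.IsPrime]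
    (hP : RingHom.ker f ≤ P) : IsRealClosedResidue (R ⧸ P) := by
  have := Ideal.map_isPrime_of_surjective hf hP
  have hk : RingHom.ker ((Ideal.Quotient.mk (P.map f)).comp f) = P := by
    rw [← RingHom.comap_ker, Ideal.mk_ker, Ideal.comap_map_of_surjective' f hf, sup_eq_left.2 hP]
  exact (hS (P.map f)).of_ringEquiv ((RingHom.quotientKerEquivOfSurjective
    (f := (Ideal.Quotient.mk (P.map f)).comp f)
    (Ideal.Quotient.mk_surjective.comp hf)).symm.trans (Ideal.quotEquivOfEq hk))

theorem isRealClosedResidue_of_surjective {R : Type u} {S : Type v} [CommRing R]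
    [CommRing S] (f : R →+* S) (hf : Function.Surjective f)
    (hR : ∀ (p : Ideal R) [p.IsPrime], IsRealClosedResidue (R ⧸ p)) (P : Ideal S) [P.IsPrime] :
    IsRealClosedResidue (S ⧸ P) := by
  have hk : RingHom.ker ((Ideal.Quotient.mk P).comp f) = P.comap f := by
    rw [← RingHom.comap_ker, Ideal.mk_ker]
  have hp : (P.comap f).IsPrime := inferInstance
  exact (hR (P.comap f)).of_ringEquiv ((Ideal.quotEquivOfEq hk).symm.trans
    (RingHom.quotientKerEquivOfSurjective (f := (Ideal.Quotient.mk P).comp f)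
    (Ideal.Quotient.mk_surjective.comp hf)))

/-- Every axiom except the first passes to images by transporting witnesses. The first fails for
non-real quotients, hence the hypothesis `h0`. -/
theorem IsElementaryRC.of_surjective {R : Type u} {S : Type v} [CommRing R] [CommRing S]
    (h : IsElementaryRC R) (f : R →+* S) (hf : Function.Surjective f)
    (h0 : ∀ x y : S, x * x + y * y = 0 → x = 0) : IsElementaryRC S where
  eq_zero_of_add := h0
  isSquare_add x y := by
    obtain ⟨x, rfl⟩ := hf x
    obtain ⟨y, rfl⟩ := hf y
    simpa using (h.isSquare_add x y).map f
  exists_sub a := by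
    obtain ⟨a, rfl⟩ := hf a
    obtain ⟨u, v, h1, h2⟩ := h.exists_sub a
    exact ⟨f u, f v, by rw [h1]; simp, by rw [← map_mul, h2, map_zero]⟩
  exists_mul_eq u v := by
    obtain ⟨u, rfl⟩ := hf u
    obtain ⟨v, rfl⟩ := hf v
    obtain ⟨c, h1, h2⟩ := h.exists_mul_eq u v
    refine ⟨f c, by simpa using congrArg f h1, fun P hP hu => ?_⟩
    exact h2 (P.comap f) inferInstance hu
  residue p _ := isRealClosedResidue_of_surjective f hf (fun q _ => h.residue q) p

theorem IsRealClosedRing.quotient {A : Type u} [CommRing A] (h : IsRealClosedRing A) (p : Ideal A)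
    [p.IsPrime] : IsRealClosedRing (A ⧸ p) :=
  (h.isElementaryRC.of_surjective (Ideal.Quotient.mk p) Ideal.Quotient.mk_surjective
    fun _ _ hxy => (h.isElementaryRC.residue p).eq_zero_of_mul_self_add_mul_self
      hxy).isRealClosedRing

theorem IsElementaryRC.of_ringEquiv {R : Type u} {S : Type v} [CommRing R] [CommRing S]
    (h : IsElementaryRC R) (e : R ≃+* S) : IsElementaryRC S :=
  h.of_surjective (e : R →+* S) e.surjective fun x y hxy => by
    have := h.eq_zero_of_add (e.symm x) (e.symm y) (by
      rw [← map_mul, ← map_mul, ← map_add, hxy, map_zero])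
    simpa using this

/-! ### Pullbacks of real closed rings -/

/-- `R`, with the surjections `π₁` and `π₂`, is the fibre product of `S` and `B` along the
surjections `f` and `g` to `C`. -/
structure IsSurjectivePullback {R S B C : Type*} [CommRing R] [CommRing S] [CommRing B]
    [CommRing C] (π₁ : R →+* S) (π₂ : R →+* B) (f : S →+* C) (g : B →+* C) : Prop where
  surj_fst : Function.Surjective π₁
  surj_snd : Function.Surjective π₂
  surj_left : Function.Surjective f
  surj_right : Function.Surjective g
  comm : ∀ r, f (π₁ r) = g (π₂ r)
  ext_zero : ∀ r, π₁ r = 0 → π₂ r = 0 → r = 0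
  exists_lift : ∀ s b, f s = g b → ∃ r, π₁ r = s ∧ π₂ r = b

namespace IsSurjectivePullback

variable {R S B C : Type*} [CommRing R] [CommRing S] [CommRing B] [CommRing C]
  {π₁ : R →+* S} {π₂ : R →+* B} {f : S →+* C} {g : B →+* C}
  (h : IsSurjectivePullback π₁ π₂ f g)
include h

theorem ext {x y : R} (h₁ : π₁ x = π₁ y) (h₂ : π₂ x = π₂ y) : x = y :=
  sub_eq_zero.1 (h.ext_zero _ (by rw [map_sub, h₁, sub_self]) (by rw [map_sub, h₂, sub_self]))

theorem ker_le_or_ker_le (P : Ideal R) (hP : P.IsPrime) :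
    RingHom.ker π₁ ≤ P ∨ RingHom.ker π₂ ≤ P := by
  refine hP.inf_le.1 fun r hr => ?_
  rw [h.ext_zero r hr.1 hr.2]
  exact P.zero_mem

/-- Witnesses found separately in `S` and `B` need not agree in `C`. Square roots there differ only
by a sign, which is absorbed into the `B`-component; for the quotient `c`, the clause about primes
settles the case in which cancellation in `C` is unavailable. -/
theorem isElementaryRC [IsDomain C] (hC : ∀ x y : C, x * x + y * y = 0 → x = 0)
    (hS : IsElementaryRC S) (hB : IsElementaryRC B) : IsElementaryRC R where
  eq_zero_of_add x y hxy := by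
    refine h.ext_zero x (hS.eq_zero_of_add _ (π₁ y) ?_) (hB.eq_zero_of_add _ (π₂ y) ?_)
    · simpa using congrArg π₁ hxy
    · simpa using congrArg π₂ hxy
  isSquare_add x y := by
    obtain ⟨s, hs⟩ := hS.isSquare_add (π₁ x) (π₁ y)
    obtain ⟨b, hb⟩ := hB.isSquare_add (π₂ x) (π₂ y)
    have hsb : f s * f s = g b * g b := by
      rw [← map_mul, ← map_mul, ← hs, ← hb]
      simp only [map_add, map_mul, h.comm]
    obtain ⟨b', hb', hsb'⟩ : ∃ b', b' * b' = b * b ∧ f s = g b' := by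
      rcases mul_self_eq_mul_self_iff.1 hsb with e | e
      · exact ⟨b, rfl, e⟩
      · exact ⟨-b, neg_mul_neg b b, by rw [map_neg, e]⟩
    obtain ⟨r, rfl, rfl⟩ := h.exists_lift s b' hsb'
    exact ⟨r, h.ext (by simpa using hs) (by simpa [hb'] using hb)⟩
  exists_sub a := by
    obtain ⟨u, v, ha, huv⟩ := hS.exists_sub (π₁ a)
    obtain ⟨u', v', ha', huv'⟩ := hB.exists_sub (π₂ a)
    have e : f u * f u - f v * f v = g u' * g u' - g v' * g v' := by
      simp only [← map_mul, ← map_sub, ← ha, ← ha', h.comm]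
    have z : f u * f v = 0 := by rw [← map_mul, huv, map_zero]
    have z' : g u' * g v' = 0 := by rw [← map_mul, huv', map_zero]
    -- In the domain `C` one member of each orthogonal pair vanishes. In the mixed cases a square
    -- equals the negative of a square, and `hC` makes everything zero.
    have key : f u * f u = g u' * g u' ∧ f v * f v = g v' * g v' := by
      rcases mul_eq_zero.1 z with e1 | e1 <;> rcases mul_eq_zero.1 z' with e2 | e2 <;>
        simp only [e1, e2, mul_zero, zero_sub, sub_zero, neg_inj] at e ⊢
      · exact ⟨trivial, e⟩
      · have h1 := hC (g u') (f v) (by rw [← e]; ring)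
        have h2 := hC (f v) (g u') (by rw [← e]; ring)
        simp [h1, h2]
      · have h1 := hC (f u) (g v') (by rw [e]; ring)
        have h2 := hC (g v') (f u) (by rw [e]; ring)
        simp [h1, h2]
      · exact ⟨e, trivial⟩
    obtain ⟨u'', hu, hu'⟩ : ∃ x, (x = u' ∨ x = -u') ∧ f u = g x := by
      rcases mul_self_eq_mul_self_iff.1 key.1 with e | e
      · exact ⟨u', .inl rfl, e⟩
      · exact ⟨-u', .inr rfl, by rw [map_neg, e]⟩
    obtain ⟨v'', hv, hv'⟩ : ∃ x, (x = v' ∨ x = -v') ∧ f v = g x := by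
      rcases mul_self_eq_mul_self_iff.1 key.2 with e | e
      · exact ⟨v', .inl rfl, e⟩
      · exact ⟨-v', .inr rfl, by rw [map_neg, e]⟩
    obtain ⟨x, rfl, rfl⟩ := h.exists_lift u u'' hu'
    obtain ⟨y, rfl, rfl⟩ := h.exists_lift v v'' hv'
    refine ⟨x, y, h.ext (by simpa using ha) ?_, h.ext (by simpa using huv) ?_⟩
    · rcases hu with e1 | e1 <;> rcases hv with e2 | e2 <;> simp [e1, e2, ha']
    · rcases hu with e1 | e1 <;> rcases hv with e2 | e2 <;> simp [e1, e2, huv']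
  exists_mul_eq u v := by
    obtain ⟨c, hc, hcP⟩ := hS.exists_mul_eq (π₁ u) (π₁ v)
    obtain ⟨d, hd, hdP⟩ := hB.exists_mul_eq (π₂ u) (π₂ v)
    -- If the image of `u` in `C` is zero, the kernels of `f` and `g` are primes containing the two
    -- images of `u`, so `c` and `d` both die. Otherwise the sum of squares is non-zero in `C` and
    -- can be cancelled.
    have hcd : f c = g d := by
      by_cases h0 : f (π₁ u) = 0
      · have h1 : f c = 0 := hcP (RingHom.ker f) (RingHom.ker_isPrime f) h0
        have h2 : g d = 0 := hdP (RingHom.ker g) (RingHom.ker_isPrime g) (by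
          rw [RingHom.mem_ker, ← h.comm, h0])
        rw [h1, h2]
      · have h1 := congrArg f hc
        have h2 := congrArg g hd
        simp only [map_mul, map_add, map_pow, ← h.comm] at h1 h2
        exact mul_left_cancel₀ (fun e => h0 (hC _ _ e)) (h1.trans h2.symm)
    obtain ⟨r, rfl, rfl⟩ := h.exists_lift c d hcd
    refine ⟨r, h.ext (by simpa using hc) (by simpa using hd), fun P hP hu => ?_⟩
    rcases h.ker_le_or_ker_le P hP with hk | hk
    · have := hcP _ (Ideal.map_isPrime_of_surjective h.surj_fst hk) (Ideal.mem_map_of_mem _ hu)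
      rwa [← Ideal.mem_comap, Ideal.comap_map_of_surjective' _ h.surj_fst, sup_eq_left.2 hk] at this
    · have := hdP _ (Ideal.map_isPrime_of_surjective h.surj_snd hk) (Ideal.mem_map_of_mem _ hu)
      rwa [← Ideal.mem_comap, Ideal.comap_map_of_surjective' _ h.surj_snd, sup_eq_left.2 hk] at this
  residue P hP := by
    rcases h.ker_le_or_ker_le P hP with hk | hk
    · exact isRealClosedResidue_quotient_of_surjective π₁ h.surj_fst
        (fun p _ => hS.residue p) P hk
    · exact isRealClosedResidue_quotient_of_surjective π₂ h.surj_snd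
        (fun p _ => hB.residue p) P hk

/-- A surjection from a local ring onto a non-trivial ring reflects units, so `π₂ r` is a unit too.
The two inverses agree in `C` by uniqueness of inverses, hence glue. -/
theorem isUnit_of_isUnit_fst [Nontrivial C] [IsLocalRing B] {r : R} (hr : IsUnit (π₁ r)) :
    IsUnit r := by
  have := IsLocalHom.of_surjective g h.surj_right
  have hb : IsUnit (π₂ r) := isUnit_of_map_unit g _ (by rw [← h.comm]; exact hr.map f)
  obtain ⟨s, hs⟩ := hr.exists_right_inv
  obtain ⟨b, hb'⟩ := hb.exists_right_inv
  have hsb : f s = g b := by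
    refine (hr.map f).mul_left_cancel ?_
    rw [← map_mul, hs, h.comm, ← map_mul, hb', map_one, map_one]
  obtain ⟨t, rfl, rfl⟩ := h.exists_lift s b hsb
  exact IsUnit.of_mul_eq_one t (h.ext (by simpa using hs) (by simpa using hb'))

theorem isLocalRing [Nontrivial C] [IsLocalRing S] [IsLocalRing B] : IsLocalRing R := by
  have : Nontrivial R := π₁.domain_nontrivial
  refine IsLocalRing.of_isUnit_or_isUnit_one_sub_self fun a => ?_
  refine (IsLocalRing.isUnit_or_isUnit_one_sub_self (π₁ a)).imp h.isUnit_of_isUnit_fst fun ha => ?_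
  exact h.isUnit_of_isUnit_fst (by simpa using ha)

end IsSurjectivePullback

/-! ### Iterated fibre products are local real closed rings -/

section FibreProduct

variable {n : ℕ} {B : Fin n → Type u} [∀ i, CommRing (B i)]

theorem exists_init_last {k : ℕ} (hk : k < n) (s : ∀ i : Fin k, B (Fin.castLE hk.le i))
    (b : B ⟨k, hk⟩) : ∃ x, init B k hk x = s ∧ last B k hk x = b :=
  ⟨Fin.snoc (α := fun i : Fin (k + 1) => B (Fin.castLE hk i)) s b,
    funext fun i => Fin.snoc_castSucc (α := fun i : Fin (k + 1) => B (Fin.castLE hk i)) b s i,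
    Fin.snoc_last (α := fun i : Fin (k + 1) => B (Fin.castLE hk i)) b s⟩

theorem eq_of_init_last {k : ℕ} (hk : k < n) {x y : ∀ i : Fin (k + 1), B (Fin.castLE hk i)}
    (h₁ : init B k hk x = init B k hk y) (h₂ : last B k hk x = last B k hk y) : x = y := by
  funext i
  induction i using Fin.lastCases with
  | last => exact h₂
  | cast i => exact congrFun h₁ i

theorem init_mem_of_mem_fibreProduct {k : ℕ} (hk : k < n)
    {S : Subring (∀ i : Fin k, B (Fin.castLE hk.le i))} {C : Type v} [CommRing C] {f : S →+* C}
    {g : B ⟨k, hk⟩ →+* C} {x} (hx : x ∈ fibreProduct B hk S f g) : init B k hk x ∈ S := by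
  obtain ⟨s, hs, -⟩ := hx
  rw [← hs]
  exact s.2

theorem isSurjectivePullback_fibreProduct {k : ℕ} (hk : k < n)
    {S : Subring (∀ i : Fin k, B (Fin.castLE hk.le i))} {C : Type v} [CommRing C] {f : S →+* C}
    {g : B ⟨k, hk⟩ →+* C} (hf : Function.Surjective f) (hg : Function.Surjective g) :
    IsSurjectivePullback
      (((init B k hk).comp (fibreProduct B hk S f g).subtype).codRestrict S
        fun x => init_mem_of_mem_fibreProduct hk x.2)
      ((last B k hk).comp (fibreProduct B hk S f g).subtype) f g := by
  have lift : ∀ s b, f s = g b → ∃ r : fibreProduct B hk S f g,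
      init B k hk r = s ∧ last B k hk r = b := fun s b hsb => by
    obtain ⟨x, h₁, h₂⟩ := exists_init_last hk s.1 b
    exact ⟨⟨x, s, h₁.symm, by rw [hsb, h₂]⟩, h₁, h₂⟩
  refine ⟨fun s => ?_, fun b => ?_, hf, hg, ?_, ?_, ?_⟩
  · obtain ⟨b, hb⟩ := hg (f s)
    obtain ⟨r, h₁, -⟩ := lift s b hb.symm
    exact ⟨r, Subtype.ext h₁⟩
  · obtain ⟨s, hs⟩ := hf (g b)
    obtain ⟨r, -, h₂⟩ := lift s b hs
    exact ⟨r, h₂⟩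
  · rintro ⟨x, s, hs, hsx⟩
    refine Eq.trans (congrArg f (Subtype.ext hs.symm)) hsx
  · rintro ⟨x, hx⟩ h₁ h₂
    refine Subtype.ext (eq_of_init_last hk ?_ h₂)
    exact (congrArg Subtype.val h₁).trans (map_zero _).symm
  · intro s b hsb
    obtain ⟨r, h₁, h₂⟩ := lift s b hsb
    exact ⟨r, Subtype.ext h₁, h₂⟩

theorem fibreProduct_congr {k : ℕ} (hk : k < n)
    {S : Subring (∀ i : Fin k, B (Fin.castLE hk.le i))} {C : Type v} [CommRing C] {f : S →+* C}
    {g : B ⟨k, hk⟩ →+* C} {C' : Type*} [CommRing C'] {f' : S →+* C'} {g' : B ⟨k, hk⟩ →+* C'}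
    (h : ∀ s b, f s = g b ↔ f' s = g' b) :
    fibreProduct B hk S f g = fibreProduct B hk S f' g' := by
  ext x
  exact exists_congr fun s => and_congr_right fun _ => h _ _

end FibreProduct

namespace IsIteratedFibreEmbedding

variable {n : ℕ} {B : Fin n → Type u} [∀ i, CommRing (B i)] {A : Type v} [CommRing A]
  {ε : A →+* ∀ i, B i}

/-- A stage of an iterated fibre product is a pullback over a domain, whose two projections are
the truncation and the projection to the last factor. -/
theorem exists_pullback (h : IsIteratedFibreEmbedding B ε) {k : ℕ} (hk1 : 1 ≤ k) (hk : k < n) :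
    ∃ (J : Ideal (B ⟨k, hk⟩)) (π₁ : truncImage B ε (k + 1) hk →+* truncImage B ε k hk.le)
      (f : truncImage B ε k hk.le →+* B ⟨k, hk⟩ ⧸ J), J.IsPrime ∧
      IsSurjectivePullback π₁ ((last B k hk).comp (truncImage B ε (k + 1) hk).subtype) f
        (Ideal.Quotient.mk J) := by
  obtain ⟨I, J, φ, -, hJ, e⟩ := h.step k hk1 hk
  rw [e]
  exact ⟨J, _, _, hJ, isSurjectivePullback_fibreProduct hk
    (φ.surjective.comp Ideal.Quotient.mk_surjective) Ideal.Quotient.mk_surjective⟩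

theorem surjective_eval (h : IsIteratedFibreEmbedding B ε) (i : Fin n) :
    Function.Surjective ((Pi.evalRingHom B i).comp ε) := by
  obtain ⟨k, hk⟩ := i
  intro b
  rcases Nat.eq_zero_or_pos k with rfl | hk1
  · obtain ⟨x, -, hx⟩ := exists_init_last hk (fun i => i.elim0) b
    have hmem : x ∈ truncImage B ε 1 hk := by rw [h.first hk]; trivial
    obtain ⟨a, rfl⟩ := hmem
    exact ⟨a, hx⟩
  · obtain ⟨J, π₁, f, -, hP⟩ := h.exists_pullback hk1 hk
    obtain ⟨⟨_, a, rfl⟩, hx⟩ := hP.surj_snd b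
    exact ⟨a, hx⟩

/-- Induction along the stages: the first is the factor `B 0`, and each further one is a pullback
over a residue domain of the new factor. -/
theorem truncImage_local_rc (h : IsIteratedFibreEmbedding B ε)
    (hB : ∀ i, IsNontrivialRCVR (B i)) {k : ℕ} (hk1 : 1 ≤ k) (hk : k ≤ n) :
    IsLocalRing (truncImage B ε k hk) ∧ IsElementaryRC (truncImage B ε k hk) := by
  have hloc : ∀ i, IsLocalRing (B i) := fun i => by
    have := (hB i).isDomain
    have := (hB i).valuationRing
    infer_instance
  induction k, hk1 using Nat.le_induction with
  | base =>
    rw [h.first hk]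
    let e : (∀ i : Fin 1, B (Fin.castLE hk i)) ≃+* B ⟨0, hk⟩ :=
      RingEquiv.piUnique (fun i : Fin 1 => B (Fin.castLE hk i))
    let e' := e.symm.trans (Subring.topEquiv (R := ∀ i : Fin 1, B (Fin.castLE hk i))).symm
    exact ⟨e'.isLocalRing, (hB _).isRealClosedRing.isElementaryRC.of_ringEquiv e'⟩
  | succ k hk1 ih =>
    obtain ⟨J, π₁, f, hJ, hP⟩ := h.exists_pullback hk1 hk
    obtain ⟨h₁, h₂⟩ := ih (Nat.le_of_succ_le hk)
    have hBk := (hB ⟨k, hk⟩).isRealClosedRing.isElementaryRC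
    exact ⟨hP.isLocalRing, hP.isElementaryRC
      (fun _ _ => (hBk.residue J).eq_zero_of_mul_self_add_mul_self) h₂ hBk⟩

theorem local_rc (h : IsIteratedFibreEmbedding B ε) (hB : ∀ i, IsNontrivialRCVR (B i))
    (hn : 1 ≤ n) : IsLocalRing A ∧ IsRealClosedRing A := by
  obtain ⟨h₁, h₂⟩ := h.truncImage_local_rc hB hn le_rfl
  let e : A ≃+* truncImage B ε n le_rfl := RingEquiv.ofBijective
    ((truncate B n le_rfl).comp ε).rangeRestrict
    ⟨fun a b hab => h.injective (congrArg Subtype.val hab), RingHom.rangeRestrict_surjective _⟩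
  exact ⟨e.symm.isLocalRing, (h₂.of_ringEquiv e.symm).isRealClosedRing⟩

theorem isSubdirectProduct (h : IsIteratedFibreEmbedding B ε) : IsSubdirectProduct B ε.range :=
  fun i b => (h.surjective_eval i b).imp' (fun a => ⟨ε a, a, rfl⟩) fun _ ha => ha

end IsIteratedFibreEmbedding

/-! ### Finite families of primes with zero intersection -/

section FinitePrimes

variable {A : Type u} [CommRing A] {n : ℕ} {p : Fin n → Ideal A}

theorem exists_le_of_iInf_eq_bot (h : ⨅ i, p i = ⊥) (P : Ideal A) (hP : P.IsPrime) :
    ∃ i, p i ≤ P := by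
  have : Finset.univ.inf p ≤ P := by
    rw [Finset.inf_univ_eq_iInf, h]
    exact bot_le
  obtain ⟨i, -, hi⟩ := hP.inf_le'.1 this
  exact ⟨i, hi⟩

theorem minimalPrimes_subset_range (hp : ∀ i, (p i).IsPrime) (h : ⨅ i, p i = ⊥) :
    minimalPrimes A ⊆ Set.range p := by
  intro q hq
  obtain ⟨i, hi⟩ := exists_le_of_iInf_eq_bot h q hq.1.1
  exact ⟨i, hi.antisymm (hq.2 ⟨hp i, bot_le⟩ hi)⟩

theorem encard_range_fin_le {α : Type*} (f : Fin n → α) : (Set.range f).encard ≤ n := by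
  rw [← Set.image_univ]
  exact (Set.encard_image_le _ _).trans (by simp)

theorem rankAt_le_encard_minimalPrimes (P : Ideal A) : rankAt A P ≤ (minimalPrimes A).encard :=
  Set.encard_le_encard fun _ hq => hq.1

theorem rank_le_encard_minimalPrimes : rank A ≤ (minimalPrimes A).encard :=
  iSup_le fun P => rankAt_le_encard_minimalPrimes P.asIdeal

theorem encard_minimalPrimes_le_rank [IsLocalRing A] : (minimalPrimes A).encard ≤ rank A := by
  refine le_trans (Set.encard_le_encard fun q hq => ?_)
    (le_iSup (fun P : PrimeSpectrum A => rankAt A P.asIdeal) (IsLocalRing.closedPoint A))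
  exact ⟨hq, IsLocalRing.le_maximalIdeal hq.1.1.ne_top⟩

/-- The minimal primes lie in the range of `p`, which has at most `n` elements, while rank `n`
requires at least `n` minimal primes. Equality throughout leaves no room for repetitions. -/
theorem eq_range_of_rank_eq (hp : ∀ i, (p i).IsPrime) (h : ⨅ i, p i = ⊥) (hr : rank A = n) :
    minimalPrimes A = Set.range p ∧ Function.Injective p := by
  have h₁ : (n : ℕ∞) ≤ (minimalPrimes A).encard := hr ▸ rank_le_encard_minimalPrimes
  have h₂ := minimalPrimes_subset_range hp h
  have h₃ := encard_range_fin_le p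
  refine ⟨((Set.finite_range p).subset h₂).eq_of_subset_of_encard_le h₂ (h₃.trans h₁), ?_⟩
  have h₄ : (Set.range p).encard = n := h₃.antisymm (h₁.trans (Set.encard_le_encard h₂))
  have h₅ : Fintype.card (Set.range p) = Fintype.card (Fin n) := by
    rw [← Nat.card_eq_fintype_card, Nat.card_coe_set_eq, Set.ncard_def, h₄]
    simp
  have := (Fintype.bijective_iff_surjective_and_card (Set.rangeFactorization p)).2
    ⟨Set.rangeFactorization_surjective, h₅.symm⟩
  exact fun i j hij => this.1 (Subtype.ext hij)

/-- Repetitions are allowed, so that a ring with fewer than `n` minimal primes still gets a family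
of length exactly `n`. -/
theorem exists_range_eq_of_encard_le {α : Type*} {s : Set α} (hs : s.Nonempty)
    (hn : s.encard ≤ n) : ∃ f : Fin n → α, Set.range f = s := by
  have hfin : s.Finite := Set.finite_of_encard_le_coe hn
  have := hfin.fintype
  have := hs.to_subtype
  obtain ⟨e⟩ : Nonempty (s ↪ Fin n) := by
    refine Function.Embedding.nonempty_of_card_le ?_
    rw [Fintype.card_fin, ← Nat.card_eq_fintype_card, Nat.card_coe_set_eq,
      ← Nat.cast_le (α := ℕ∞), hfin.cast_ncard_eq]
    exact hn
  refine ⟨Subtype.val ∘ Function.invFun e, ?_⟩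
  rw [Set.range_comp, (Function.invFun_surjective e.injective).range_eq, Set.image_univ,
    Subtype.range_coe]

end FinitePrimes

/-! ### Subdirect products of valuation rings are SV-rings of bounded rank -/

theorem preValuationRing_quotient_of_surjective {A : Type u} {B : Type v} [CommRing A]
    [CommRing B] (f : A →+* B) (hf : Function.Surjective f) [hB : PreValuationRing B]
    (P : Ideal A) (hP : RingHom.ker f ≤ P) : PreValuationRing (A ⧸ P) where
  cond' a b := by
    obtain ⟨a, rfl⟩ := Ideal.Quotient.mk_surjective a
    obtain ⟨b, rfl⟩ := Ideal.Quotient.mk_surjective b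
    obtain ⟨c, hc⟩ := PreValuationRing.cond (f a) (f b)
    obtain ⟨c, rfl⟩ := hf c
    refine ⟨Ideal.Quotient.mk P c, hc.imp (fun h => ?_) fun h => ?_⟩
    all_goals
      rw [← map_mul, Ideal.Quotient.eq]
      refine hP ?_
      rw [RingHom.mem_ker, map_sub, map_mul, h, sub_self]

/-- The kernels of the `n` projections are primes with zero intersection. Every minimal prime is
therefore one of them, and every residue domain is a quotient of some `B i`. -/
theorem isSVRing_and_rank_le {A : Type u} [CommRing A] {n : ℕ} {B : Fin n → Type v}
    [∀ i, CommRing (B i)] {ε : A →+* ∀ i, B i} (hB : ∀ i, IsNontrivialRCVR (B i))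
    (hε : Function.Injective ε) (hs : IsSubdirectProduct B ε.range) :
    IsSVRing A ∧ rank A ≤ n := by
  let f : ∀ i, A →+* B i := fun i => (Pi.evalRingHom B i).comp ε
  have hf : ∀ i, Function.Surjective (f i) := fun i b => by
    obtain ⟨⟨_, a, rfl⟩, h⟩ := hs i b
    exact ⟨a, h⟩
  have hprime : ∀ i, (RingHom.ker (f i)).IsPrime := fun i => by
    have := (hB i).isDomain
    exact RingHom.ker_isPrime _
  have hinf : ⨅ i, RingHom.ker (f i) = ⊥ := by
    refine (Submodule.eq_bot_iff _).2 fun a ha => hε ?_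
    rw [map_zero]
    funext i
    exact (Ideal.mem_iInf.1 ha i)
  refine ⟨fun P hP => ?_, rank_le_encard_minimalPrimes.trans
    ((Set.encard_le_encard (minimalPrimes_subset_range hprime hinf)).trans
      (encard_range_fin_le _))⟩
  obtain ⟨i, hi⟩ := exists_le_of_iInf_eq_bot hinf P hP
  have := (hB i).isDomain
  have := (hB i).valuationRing
  have := preValuationRing_quotient_of_surjective (f i) (hf i) P hi
  exact {}

/-! ### The intrinsic description -/

section Intrinsic

variable {A : Type u} [CommRing A] {n : ℕ} {p : Fin n → Ideal A}

theorem imageToResidue_surjective (k : ℕ) (hk : k < n) :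
    Function.Surjective (imageToResidue p k hk) := fun c => by
  obtain ⟨a, rfl⟩ := Ideal.Quotient.mk_surjective c
  exact ⟨_, imageToResidue_apply p k hk a⟩

theorem residueToResidue_surjective (j : Fin n) : Function.Surjective (residueToResidue p j) :=
  Ideal.Quotient.factor_surjective _

theorem canonicalMap_injective (h : ⨅ i, p i = ⊥) : Function.Injective (canonicalMap p) := by
  refine (injective_iff_map_eq_zero _).2 fun a ha => ?_
  rw [← Ideal.mem_bot, ← h, Ideal.mem_iInf]
  exact fun i => Ideal.Quotient.eq_zero_iff_mem.1 (congrFun ha i)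

/-- This is the Chinese remainder argument, valid for arbitrary ideals: if `a - b = i + j` with `i`
in the earlier ideals and `j` in `p k`, then `a - i = b + j` represents both components. -/
theorem canonicalImage_eq_fibreProduct (k : ℕ) (hk : k < n) :
    canonicalImage p (k + 1) hk =
      fibreProduct (fun i => A ⧸ p i) hk (canonicalImage p k hk.le)
        (imageToResidue p k hk) (residueToResidue p ⟨k, hk⟩) := by
  ext x
  constructor
  · rintro ⟨a, rfl⟩
    exact ⟨_, rfl, imageToResidue_apply p k hk a⟩
  · rintro ⟨⟨_, a, rfl⟩, hs, hx⟩
    obtain ⟨b, hb⟩ := Ideal.Quotient.mk_surjective (last (fun i => A ⧸ p i) k hk x)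
    have hab : Ideal.Quotient.mk (branchIdeal p ⟨k, hk⟩) a = Ideal.Quotient.mk _ b := by
      refine (imageToResidue_apply p k hk a).symm.trans (hx.trans ?_)
      rw [← hb]
      rfl
    obtain ⟨i, hi, j, hj, hij⟩ := Submodule.mem_sup.1 (Ideal.Quotient.eq.1 hab)
    refine ⟨a - i, eq_of_init_last hk ?_ ?_⟩
    · rw [← hs]
      funext l
      refine Ideal.Quotient.eq.2 ?_
      rw [sub_sub_cancel_left]
      simp only [Ideal.mem_iInf] at hi
      exact (Ideal.neg_mem_iff _).2 (hi _ l.2)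
    · rw [← hb]
      refine Ideal.Quotient.eq.2 ?_
      have hj' : a - i - b = j := by linear_combination -hij
      rw [hj']
      exact hj

theorem IsPrimePresentation.isIteratedFibreEmbedding (h : IsPrimePresentation p) :
    IsIteratedFibreEmbedding (fun i => A ⧸ p i) (canonicalMap p) where
  injective := h.injective
  first hn := by
    refine eq_top_iff.2 fun x _ => ?_
    obtain ⟨a, ha⟩ := Ideal.Quotient.mk_surjective (x 0)
    refine ⟨a, funext fun i => ?_⟩
    obtain rfl := Subsingleton.elim i 0
    exact ha
  step k hk1 hk := by
    have hq := h.isPrime_branchIdeal ⟨k, hk⟩ hk1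
    let e₁ := RingHom.quotientKerEquivOfSurjective (imageToResidue_surjective (p := p) k hk)
    let e₂ := RingHom.quotientKerEquivOfSurjective (residueToResidue_surjective (p := p) ⟨k, hk⟩)
    -- Both residue rings are identified with `A ⧸ branchIdeal p k`, so the isomorphism is the
    -- composite through it.
    refine ⟨RingHom.ker (imageToResidue p k hk), RingHom.ker (residueToResidue p ⟨k, hk⟩),
      e₁.trans e₂.symm, RingHom.ker_isPrime _, RingHom.ker_isPrime _, (h.step k hk1 hk).trans ?_⟩
    exact fibreProduct_congr hk fun s b => (e₂.symm_apply_eq (x := imageToResidue p k hk s)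
      (y := Ideal.Quotient.mk _ b)).symm

end Intrinsic

/-! ### Sums of radical ideals in real closed rings -/

/-- Radical ideals are convex, and each of their elements lies below the square of a non-negative
element of the same ideal. So if `x * x = a + b`, then `x * x ≤ u * u + v * v ≤ (u + v) * (u + v)`
and `|x| ≤ u + v`; Riesz decomposition splits `x⁺` and `x⁻` into a part below `u` and a part below
`v`. -/
theorem IsRealClosedRing.isRadical_sup {A : Type u} [CommRing A] (h : IsRealClosedRing A)
    {I J : Ideal A} (hI : I.IsRadical) (hJ : J.IsRadical) : (I ⊔ J).IsRadical := by
  obtain ⟨hred, ⟨_, _, hsq, hinf, hdvd⟩, -, -⟩ := h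
  have hnn : ∀ a : A, 0 ≤ a * a := fun a => (hsq _).2 ⟨a, rfl⟩
  have hpn := posPart_mul_negPart_eq_zero hinf hnn
  have habs : ∀ a : A, |a| * |a| = a * a := fun a => by
    have h1 := hpn a
    have h2 := posPart_sub_negPart a
    have h3 := posPart_add_negPart a
    rw [← h3]
    nth_rw 5 6 [← h2]
    linear_combination 4 * h1
  have hrad : ∀ {K : Ideal A}, K.IsRadical → ∀ a, a * a ∈ K → a ∈ K := fun hK a ha =>
    hK ⟨2, by rwa [sq]⟩
  have hconv : ∀ {K : Ideal A}, K.IsRadical → ∀ a b, 0 ≤ a → a ≤ b → b ∈ K → a ∈ K := by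
    intro K hK a b ha hab hb
    obtain ⟨c, hc⟩ := hdvd a b ha hab
    exact hrad hK a (by rw [← sq, ← hc]; exact K.mul_mem_right _ hb)
  have hroot : ∀ {K : Ideal A}, K.IsRadical → ∀ a ∈ K, ∃ u, 0 ≤ u ∧ u ∈ K ∧ a ≤ u * u := by
    intro K hK a ha
    obtain ⟨u, hu⟩ := (hsq _).1 (abs_nonneg a)
    have hu' : |u| * |u| = |a| := by rw [habs, hu]
    refine ⟨|u|, abs_nonneg u, hrad hK _ (hrad hK _ ?_), hu'.symm ▸ le_abs_self a⟩
    rw [hu', habs]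
    exact K.mul_mem_right _ ha
  have hle : ∀ y w : A, 0 ≤ y → 0 ≤ w → y * y ≤ w * w → y ≤ w := by
    intro y w hy hw hyw
    have hd := posPart_nonneg (y - w)
    have h1 := hpn (y - w)
    have h2 := posPart_sub_negPart (y - w)
    have hdy : (y - w)⁺ ≤ y + w := sup_le
      (by rw [sub_le_iff_le_add, add_assoc]; exact le_add_of_nonneg_right (add_nonneg hw hw))
      (add_nonneg hy hw)
    rw [← sub_nonpos, ← posPart_eq_zero]
    set d := (y - w)⁺
    -- Since `d` annihilates the negative part of `y - w`, `d * d = d * (y - w)`, so the left side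
    -- is `d * (y * y - w * w)`. With `d ≤ y + w` this gives `d * d * d ≤ 0`.
    have h3 : d * d * (y + w) ≤ 0 := by
      have : d * d * (y + w) = - (d * (w * w - y * y)) := by
        linear_combination (y + w) * d * h2 + (y + w) * h1
      rw [this, neg_nonpos]
      exact mul_nonneg hd (sub_nonneg.2 hyw)
    have h4 : d * d * d = 0 := le_antisymm
      ((mul_le_mul_of_nonneg_left hdy (hnn d)).trans h3) (mul_nonneg (hnn d) hd)
    exact IsReduced.eq_zero d ⟨3, by rw [pow_three', h4]⟩
  have hsup : ∀ y u v : A, 0 ≤ y → 0 ≤ u → 0 ≤ v → u ∈ I → v ∈ J → y ≤ u + v → y ∈ I ⊔ J := by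
    intro y u v hy hu hv huI hvJ hyuv
    rw [← add_sub_cancel (y ⊓ u) y]
    refine add_mem (Ideal.mem_sup_left (hconv hI _ _ (le_inf hy hu) inf_le_right huI))
      (Ideal.mem_sup_right (hconv hJ _ _ (sub_nonneg.2 inf_le_left) ?_ hvJ))
    rw [sub_le_comm]
    exact le_inf (sub_le_self _ hv) (sub_le_iff_le_add.2 hyuv)
  rw [Ideal.isRadical_iff_pow_one_lt 2 one_lt_two]
  intro x hx
  obtain ⟨a, ha, b, hb, hab⟩ := Submodule.mem_sup.1 hx
  obtain ⟨u, hu, huI, hau⟩ := hroot hI a ha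
  obtain ⟨v, hv, hvJ, hbv⟩ := hroot hJ b hb
  have hx' : |x| ≤ u + v := by
    refine hle _ _ (abs_nonneg x) (add_nonneg hu hv) ?_
    rw [habs, ← sq, ← hab]
    refine (add_le_add hau hbv).trans ?_
    have : (u + v) * (u + v) = (u * u + v * v) + (u * v + u * v) := by ring
    rw [this]
    exact le_add_of_nonneg_right (add_nonneg (mul_nonneg hu hv) (mul_nonneg hu hv))
  rw [← posPart_add_negPart] at hx'
  rw [← posPart_sub_negPart x]
  exact sub_mem
    (hsup _ u v (posPart_nonneg x) hu hv huI hvJ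
      ((le_add_of_nonneg_right (negPart_nonneg x)).trans hx'))
    (hsup _ u v (negPart_nonneg x) hu hv huI hvJ
      ((le_add_of_nonneg_left (posPart_nonneg x)).trans hx'))

/-- Modulo `p` one of `x`, `y` divides the other, say `y = x * c`; then `y ^ 2` is `c * (x * y)`
modulo `p`, hence lies in `q`. -/
theorem isPrime_of_isRadical_of_le {A : Type u} [CommRing A] {p q : Ideal A}
    [PreValuationRing (A ⧸ p)] (hq : q.IsRadical) (hpq : p ≤ q) (hne : q ≠ ⊤) : q.IsPrime := by
  have key : ∀ x y c : A, x * y ∈ q →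
      Ideal.Quotient.mk p x * Ideal.Quotient.mk p c = Ideal.Quotient.mk p y → y ∈ q := by
    intro x y c hxy hc
    rw [← map_mul, Ideal.Quotient.eq] at hc
    refine hq ⟨2, ?_⟩
    have : y ^ 2 = c * (x * y) - y * (x * c - y) := by ring
    rw [this]
    exact sub_mem (q.mul_mem_left _ hxy) (q.mul_mem_left _ (hpq hc))
  refine ⟨hne, fun {x y} hxy => ?_⟩
  obtain ⟨c, hc⟩ := PreValuationRing.cond (Ideal.Quotient.mk p x) (Ideal.Quotient.mk p y)
  obtain ⟨c, rfl⟩ := Ideal.Quotient.mk_surjective c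
  rcases hc with hc | hc
  · exact .inr (key x y c hxy hc)
  · exact .inl (key y x c (by rwa [mul_comm]) hc)

/-- A minimal prime that is also the maximal ideal is the only prime, so it equals the nilradical,
which is zero, and `A` would be a field. -/
theorem not_isField_quotient_of_mem_minimalPrimes {A : Type u} [CommRing A] [IsLocalRing A]
    [IsReduced A] (hA : ¬ IsField A) {p : Ideal A} (hp : p ∈ minimalPrimes A) :
    ¬ IsField (A ⧸ p) := by
  intro hf
  have hmax : p.IsMaximal := Ideal.Quotient.maximal_of_isField p hf
  obtain rfl := IsLocalRing.eq_maximalIdeal hmax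
  refine hA (IsLocalRing.isField_iff_maximalIdeal_eq.2 (eq_bot_iff.2 fun x hx => ?_))
  have hnil : x ∈ nilradical A := by
    rw [nilradical_eq_sInf, Submodule.mem_sInf]
    exact fun q hq => hp.2 ⟨hq, bot_le⟩ (IsLocalRing.le_maximalIdeal hq.ne_top) hx
  exact (mem_nilradical.1 hnil).eq_zero

theorem exists_isPrimePresentation {A : Type u} [CommRing A] (hA : ¬ IsField A) {n : ℕ}
    [IsLocalRing A] (hrc : IsRealClosedRing A) (hSV : IsSVRing A) (hr : rank A ≤ n) :
    ∃ p : Fin n → Ideal A, IsPrimePresentation p := by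
  have := hrc.isReduced
  have hne : (minimalPrimes A).Nonempty :=
    Set.nonempty_coe_sort.1 (Ideal.nonempty_minimalPrimes bot_ne_top)
  obtain ⟨p, hp⟩ := exists_range_eq_of_encard_le hne (encard_minimalPrimes_le_rank.trans hr)
  have hmin : ∀ i, p i ∈ minimalPrimes A := fun i => hp ▸ Set.mem_range_self i
  have hprime : ∀ i, (p i).IsPrime := fun i => (hmin i).1.1
  have hinf : ⨅ i, p i = ⊥ := by
    rw [← sInf_range, hp]
    refine (Ideal.sInf_minimalPrimes (I := (⊥ : Ideal A))).trans ?_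
    exact nilradical_eq_zero A
  refine ⟨p, hprime, hinf, fun j hj => ?_, fun i => ?_, canonicalMap_injective hinf,
    fun k _ hk => canonicalImage_eq_fibreProduct k hk⟩
  · have := hSV (p j)
    refine isPrime_of_isRadical_of_le (p := p j) (hrc.isRadical_sup ?_ (hprime j).isRadical)
      le_sup_right ?_
    · exact Ideal.isRadical_iInf _ fun i => Ideal.isRadical_iInf _ fun _ => (hprime i).isRadical
    · have h0 : (⟨0, by omega⟩ : Fin n) < j := hj
      refine ne_top_of_le_ne_top (IsLocalRing.maximalIdeal.isMaximal A).ne_top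
        (sup_le (fun a ha => ?_) (IsLocalRing.le_maximalIdeal (hprime j).ne_top))
      simp only [Ideal.mem_iInf] at ha
      exact IsLocalRing.le_maximalIdeal (hprime _).ne_top (ha _ h0)
  · exact ⟨hrc.quotient (p i), inferInstance, hSV (p i),
      not_isField_quotient_of_mem_minimalPrimes hA (hmin i)⟩

end RealClosedSV

theorem theoremT {A : Type u} [CommRing A] (hA : ¬ IsField A) (n : ℕ) (hn : 2 ≤ n) :
    List.TFAE [
      -- `A` is a local real closed SV-ring of rank at most `n`
      IsLocalRing A ∧ RealClosedSV.IsRealClosedRing A ∧ RealClosedSV.IsSVRing A ∧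
        RealClosedSV.rank A ≤ n,
      -- `A` is local real closed and a subdirect product of `n` non-trivial real closed
      -- valuation rings
      IsLocalRing A ∧ RealClosedSV.IsRealClosedRing A ∧
        ∃ (B : Fin n → Type u) (_ : ∀ i, CommRing (B i)) (ε : A →+* ∀ i, B i),
          (∀ i, RealClosedSV.IsNontrivialRCVR (B i)) ∧ Function.Injective ε ∧
          RealClosedSV.IsSubdirectProduct B ε.range,
      -- `A` is an iterated fibre product of `n` non-trivial real closed valuation rings
      ∃ (B : Fin n → Type u) (_ : ∀ i, CommRing (B i)) (ε : A →+* ∀ i, B i),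
        (∀ i, RealClosedSV.IsNontrivialRCVR (B i)) ∧
        RealClosedSV.IsIteratedFibreEmbedding B ε,
      -- the intrinsic description
      ∃ p : Fin n → Ideal A, RealClosedSV.IsPrimePresentation p] ∧
    -- the primes are the minimal primes if the rank is `n`
    ∀ p : Fin n → Ideal A, RealClosedSV.IsPrimePresentation p → RealClosedSV.rank A = n →
      (∀ i j, i ≠ j → ¬ p i ≤ p j) ∧ minimalPrimes A = Set.range p := by

  refine ⟨?_, fun p hp hr => ?_⟩
  · tfae_have 1 → 4 := fun ⟨_, hrc, hSV, hr⟩ =>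
      RealClosedSV.exists_isPrimePresentation hA hrc hSV hr
    tfae_have 4 → 3 := fun ⟨p, hp⟩ =>
      ⟨fun i => A ⧸ p i, inferInstance, RealClosedSV.canonicalMap p, hp.isNontrivialRCVR,
        hp.isIteratedFibreEmbedding⟩
    tfae_have 3 → 2 := fun ⟨B, _, ε, hB, hε⟩ =>
      ⟨(hε.local_rc hB (by omega)).1, (hε.local_rc hB (by omega)).2, B, inferInstance, ε, hB,
        hε.injective, hε.isSubdirectProduct⟩
    tfae_have 2 → 1 := fun ⟨hloc, hrc, B, _, ε, hB, hε, hs⟩ =>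
      ⟨hloc, hrc, RealClosedSV.isSVRing_and_rank_le hB hε hs⟩
    tfae_finish
  · obtain ⟨hmin, hinj⟩ := RealClosedSV.eq_range_of_rank_eq hp.isPrime hp.iInf_eq_bot hr
    refine ⟨fun i j hij hle => hij (hinj (hle.antisymm ?_)), hmin⟩
    have hj : p j ∈ minimalPrimes A := hmin ▸ Set.mem_range_self j
    exact hj.2 ⟨hp.isPrime i, bot_le⟩ hle
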